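/- Let $n>1$ and let $\mathbb M^n$ be $n$-dimensional Minkowski space, $\mathbb R^n$ with the form $\langle x,y\rangle=-x_0y_0+\sum_{i=1}^{n-1}x_iy_i$ and Lebesgue measure. Let $\mathcal L_0$ be the connected component of the identity in the Lorentz group $\mathrm O(n-1,1)$ of this form. Let $\Omega$ be the set of locally finite subsets ("sprinklings") of $\mathbb M^n$, with the $\sigma$-algebra generated by the maps $\omega\mapsto\#(\omega\cap B)$, $B$ a bounded Borel set. Fix a point $p\in\mathbb M^n$ and let $\mathcal L_0$ act on $\mathbb M^n$ with $p$ as fixed point, $x\mapsto p+\Lambda(x-p)$, and hence on $\Omega$; we write $\Lambda\omega$ for the image of $\omega$. Let $\mathcal H=\{x:\langle x,x\rangle=-1,\ x_0>0\}$ be the hyperboloid of unit future-timelike vectors and $\mathcal S=\{x:\langle x,x\rangle=1\}$ the hyperboloid of unit spacelike vectors, on both of which $\mathcal L_0$ acts linearly. Let $X$ be any one of the following spaces: (a) $X=\mathcal S$ (spacelike directions); (b) $X=\prod_{i=1}^k X_i$ with $k\ge1$ and each $X_i\in\{\mathcal H,\mathcal S\}$, with the product $\sigma$-algebra and the diagonal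 action of $\mathcal L_0$ (finite tuples of timelike and/or spacelike directions, such as reference frames); (c) $X=\bigl(\prod_{i=1}^k X_i\bigr)/G$ with $\prod_i X_i$ as in (b) and $G$ a group of permutations of $\{1,\dots,k\}$, each of which only permutes factors of the same kind, with the quotient $\sigma$-algebra and the induced action (finite sets of directions). Then: (i) there is no $\mathcal L_0$-invariant probability measure on $X$; (ii) there is no measurable map $D:\Omega\to X$ with $D(\Lambda\omega)=\Lambda D(\omega)$ for all $\Lambda\in\mathcal L_0$ and $\omega\in\Omega$; (iii) more strongly, let $\mu$ be the law on $\Omega$ of a Poisson process of density $\rho>0$, that is, a probability measure under which $\#(\omega\cap B)$ is Poisson distributed with mean $\rho\,\mathrm{vol}(B)$ for every bounded Borel set $B$ and the numbers of points in finitely many pairwise disjoint such sets are independent. Then there is no measurable $\mathcal L_0$-invariant set $A\subseteq\Omega$ with $\mu(A)>0$ that admits a measurable map $D:A\to X$ with $D(\Lambda\omega)=\Lambda D(\omega)$ for all $\Lambda\in\mathcal L_0$ and $\omega\in A$. -/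

import Mathlib

open MeasureTheory ProbabilityTheory
open scoped NNReal Matrix

/-- Minkowski space of dimension `d + 1`; coordinate `0` is time.  Its volume element is Lebesgue
measure, the canonical `volume` of this type. -/
abbrev Mink (d : ℕ) : Type := Fin (d + 1) → ℝ

/-- The Minkowski inner product, of signature `(-, +, …, +)`. -/
def minkForm {d : ℕ} (x y : Mink d) : ℝ :=
  -(x 0 * y 0) + ∑ i : Fin d, x i.succ * y i.succ

/-- The full Lorentz group `O(d, 1)`, as a (topological) subgroup of `GL(d + 1, ℝ)`. -/
def fullLorentzGroup (d : ℕ) : Subgroup (GL (Fin (d + 1)) ℝ) where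
  carrier := {Λ | ∀ x y : Mink d, minkForm (Λ.val *ᵥ x) (Λ.val *ᵥ y) = minkForm x y}
  one_mem' := by intro x y; simp
  mul_mem' := by
    intro a b ha hb x y
    rw [Units.val_mul, ← Matrix.mulVec_mulVec, ← Matrix.mulVec_mulVec, ha, hb]
  inv_mem' := by
    intro a ha x y
    rw [← ha, Matrix.mulVec_mulVec, Matrix.mulVec_mulVec, Units.mul_inv, Matrix.one_mulVec,
      Matrix.one_mulVec]

/-- The connected component of the identity in `O(d, 1)`. -/
abbrev LorentzGroup (d : ℕ) : Type :=
  Subgroup.connectedComponentOfOne (fullLorentzGroup d)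

/-- The linear action of a Lorentz transformation on vectors. -/
def lorentzVec {d : ℕ} (Λ : LorentzGroup d) (x : Mink d) : Mink d :=
  Λ.val.val.val *ᵥ x

/-- The action of a Lorentz transformation on spacetime points with fixed point `p`. -/
def lorentzAt {d : ℕ} (p : Mink d) (Λ : LorentzGroup d) (x : Mink d) : Mink d :=
  p + lorentzVec Λ (x - p)

theorem lorentzVec_one {d : ℕ} (x : Mink d) : lorentzVec 1 x = x := by
  simp [lorentzVec]

theorem lorentzVec_mul {d : ℕ} (Λ Λ' : LorentzGroup d) (x : Mink d) :
    lorentzVec (Λ * Λ') x = lorentzVec Λ (lorentzVec Λ' x) := by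
  simp [lorentzVec, Matrix.mulVec_mulVec]

theorem minkForm_lorentzVec {d : ℕ} (Λ : LorentzGroup d) (x y : Mink d) :
    minkForm (lorentzVec Λ x) (lorentzVec Λ y) = minkForm x y :=
  Λ.val.property x y

theorem continuous_lorentzAt {d : ℕ} (p : Mink d) (Λ : LorentzGroup d) :
    Continuous (lorentzAt p Λ) := by
  unfold lorentzAt lorentzVec
  fun_prop

theorem lorentzAt_inv {d : ℕ} (p : Mink d) (Λ : LorentzGroup d) (x : Mink d) :
    lorentzAt p Λ⁻¹ (lorentzAt p Λ x) = x := by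
  simp [lorentzAt, ← lorentzVec_mul, lorentzVec_one]

/-! ### Directions -/

/-- The two kinds of directions. -/
inductive DirKind
  | timelike
  | spacelike

/-- The hyperboloid of unit future-timelike vectors, respectively of unit spacelike vectors. -/
def hyperboloid (d : ℕ) : DirKind → Set (Mink d)
  | .timelike => {x | minkForm x x = -1 ∧ 0 < x 0}
  | .spacelike => {x | minkForm x x = 1}

/-- The identity component of the Lorentz group preserves both hyperboloids. -/
theorem lorentzVec_mem_hyperboloid {d : ℕ} (Λ : LorentzGroup d) (κ : DirKind) {x : Mink d}
    (hx : x ∈ hyperboloid d κ) : lorentzVec Λ x ∈ hyperboloid d κ := by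
  cases κ with
  | spacelike => exact (minkForm_lorentzVec Λ x x).trans hx
  | timelike =>
    refine ⟨(minkForm_lorentzVec Λ x x).trans hx.1, ?_⟩
    by_contra! hneg
    have hconn : IsPreconnected (Set.univ : Set (LorentzGroup d)) := by
      have h : IsPreconnected (connectedComponent (1 : fullLorentzGroup d)) :=
        isPreconnected_connectedComponent
      exact (isPreconnected_iff_preconnectedSpace.mp h).isPreconnected_univ
    have hcont : Continuous fun Λ : LorentzGroup d => lorentzVec Λ x 0 := by
      have h1 : Continuous fun Λ : LorentzGroup d => Λ.val.val.val :=
        Units.continuous_val.comp (continuous_subtype_val.comp continuous_subtype_val)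
      exact (continuous_apply 0).comp (h1.matrix_mulVec continuous_const)
    obtain ⟨Λ₀, -, h0⟩ := hconn.intermediate_value (Set.mem_univ Λ) (Set.mem_univ 1)
      hcont.continuousOn ⟨hneg, by simpa [lorentzVec_one] using hx.2.le⟩
    have h2 := (minkForm_lorentzVec Λ₀ x x).trans hx.1
    have h3 : 0 ≤ ∑ i : Fin d, lorentzVec Λ₀ x i.succ * lorentzVec Λ₀ x i.succ :=
      Finset.sum_nonneg fun i _ => mul_self_nonneg _
    simp only [minkForm] at h2
    simp only at h0
    rw [h0] at h2
    linarith

/-- The Lorentz group acts on each hyperboloid. -/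
instance hyperboloidAction (d : ℕ) (κ : DirKind) :
    MulAction (LorentzGroup d) (hyperboloid d κ) where
  smul Λ x := ⟨lorentzVec Λ x.val, lorentzVec_mem_hyperboloid Λ κ x.property⟩
  one_smul x := Subtype.ext (lorentzVec_one x.val)
  mul_smul Λ Λ' x := Subtype.ext (lorentzVec_mul Λ Λ' x.val)

/-- The product of `k` copies of the two hyperboloids, the `i`-th factor being of kind `τ i`, with
the product `σ`-algebra and the diagonal action of the Lorentz group. -/
abbrev DirTuple (d : ℕ) {k : ℕ} (τ : Fin k → DirKind) : Type :=
  (i : Fin k) → hyperboloid d (τ i)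

/-- Two tuples of directions are equivalent if a permutation in `G` of the entries carries one into
the other. -/
def permSetoid (d : ℕ) {k : ℕ} (τ : Fin k → DirKind) (G : Subgroup (Equiv.Perm (Fin k))) :
    Setoid (DirTuple d τ) where
  r v w := ∃ g ∈ G, ∀ i, (w i : Mink d) = v (g i)
  iseqv :=
    { refl := fun v => ⟨1, G.one_mem, fun _ => rfl⟩
      symm := by
        rintro v w ⟨g, hg, h⟩
        exact ⟨g⁻¹, G.inv_mem hg, fun i => by
          have key : ∀ j, j = i → (v i : Mink d) = v j := by rintro _ rfl; rfl
          exact (key _ (g.apply_symm_apply i)).trans (h _).symm⟩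
      trans := by
        rintro u v w ⟨g, hg, h⟩ ⟨g', hg', h'⟩
        exact ⟨g * g', G.mul_mem hg hg', fun i => by simp [h, h']⟩ }

/-- The quotient of the product of hyperboloids by the permutation group `G`, with the quotient
`σ`-algebra. -/
abbrev DirQuotient (d : ℕ) {k : ℕ} (τ : Fin k → DirKind) (G : Subgroup (Equiv.Perm (Fin k))) :
    Type :=
  Quotient (permSetoid d τ G)

/-- The Lorentz group acts on the quotient through representatives. -/
instance dirQuotientAction (d : ℕ) {k : ℕ} (τ : Fin k → DirKind)
    (G : Subgroup (Equiv.Perm (Fin k))) : MulAction (LorentzGroup d) (DirQuotient d τ G) where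
  smul Λ := Quotient.map (fun v => Λ • v) (by
    rintro v w ⟨g, hg, h⟩
    exact ⟨g, hg, fun i => congrArg (lorentzVec Λ) (h i)⟩)
  one_smul q := by
    induction q using Quotient.inductionOn with
    | h v => exact congrArg (Quotient.mk _) (one_smul (LorentzGroup d) v)
  mul_smul Λ Λ' q := by
    induction q using Quotient.inductionOn with
    | h v => exact congrArg (Quotient.mk _) (mul_smul Λ Λ' v)

/-! ### Sprinklings -/

/-- The space of possible sprinklings: the locally finite subsets of Minkowski space. -/
def Sprinkling (d : ℕ) : Type :=
  {ω : Set (Mink d) // ∀ K : Set (Mink d), IsCompact K → (ω ∩ K).Finite}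

/-- The number of sprinkled points in the region `B` (finite whenever `B` is bounded). -/
noncomputable def Sprinkling.count {d : ℕ} (B : Set (Mink d)) (ω : Sprinkling d) : ℕ :=
  (ω.val ∩ B).ncard

/-- The `σ`-algebra generated by the numbers of points in bounded Borel regions. -/
noncomputable instance sprinklingMeasurableSpace (d : ℕ) : MeasurableSpace (Sprinkling d) :=
  ⨆ B : {B : Set (Mink d) // MeasurableSet B ∧ Bornology.IsBounded B},
    MeasurableSpace.comap (Sprinkling.count B.val) ⊤

/-- The action of the Lorentz group on sprinklings, with fixed point `p`. -/
def Sprinkling.act {d : ℕ} (p : Mink d) (Λ : LorentzGroup d) (ω : Sprinkling d) :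
    Sprinkling d :=
  ⟨lorentzAt p Λ '' ω.val, by
    intro K hK
    refine ((ω.property _ (hK.image (continuous_lorentzAt p Λ⁻¹))).image (lorentzAt p Λ)).subset ?_
    rintro _ ⟨⟨x, hx, rfl⟩, hxK⟩
    exact ⟨x, ⟨hx, lorentzAt p Λ x, hxK, lorentzAt_inv p Λ x⟩, rfl⟩⟩

/-- `μ` is the law of the Poisson process of density `ρ`: the number of points in a bounded Borel
region of volume `V` is Poisson distributed with mean `ρ V`, and the numbers of points in finitely
many pairwise disjoint such regions are independent. -/
structure IsPoissonSprinkling {d : ℕ} (ρ : ℝ≥0) (μ : Measure (Sprinkling d)) : Prop where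
  isProbabilityMeasure : IsProbabilityMeasure μ
  map_count : ∀ B : Set (Mink d), MeasurableSet B → Bornology.IsBounded B →
    μ.map (Sprinkling.count B) = poissonMeasure (ρ * (volume B).toNNReal)
  indep : ∀ (m : ℕ) (B : Fin m → Set (Mink d)), (∀ i, MeasurableSet (B i)) →
    (∀ i, Bornology.IsBounded (B i)) → Pairwise (fun i j => Disjoint (B i) (B j)) →
    iIndepFun (fun i => Sprinkling.count (B i)) μ

/-! ### The impossibility assertions, for a target space `X` with an action of the Lorentz group -/

/-- There is a measurable map `D` from all sprinklings to `X` that commutes with the Lorentz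
transformations about `p`. -/
def HasEquivariantMap {d : ℕ} (p : Mink d) (X : Type) [MeasurableSpace X]
    [MulAction (LorentzGroup d) X] : Prop :=
  ∃ D : Sprinkling d → X, Measurable D ∧
    ∀ (Λ : LorentzGroup d) (ω : Sprinkling d), D (ω.act p Λ) = Λ • D ω

/-- There is a measurable map `D` to `X`, defined on a measurable set `A` of sprinklings that has
nonzero measure under `μ`, that commutes with the Lorentz transformations about `p` (in particular
`A` is invariant). -/
def HasPartialEquivariantMap {d : ℕ} (p : Mink d) (μ : Measure (Sprinkling d)) (X : Type)
    [MeasurableSpace X] [MulAction (LorentzGroup d) X] : Prop :=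
  ∃ (A : Set (Sprinkling d)) (D : A → X), MeasurableSet A ∧ μ A ≠ 0 ∧ Measurable D ∧
    ∀ (Λ : LorentzGroup d) (ω : A), ∃ h : ω.val.act p Λ ∈ A, D ⟨ω.val.act p Λ, h⟩ = Λ • D ω

/-- There is a Lorentz invariant probability measure on `X`. -/
def HasInvariantProbability (d : ℕ) (X : Type) [MeasurableSpace X]
    [MulAction (LorentzGroup d) X] : Prop :=
  ∃ ν : Measure X, IsProbabilityMeasure ν ∧ SMulInvariantMeasure (LorentzGroup d) X ν

/-- `X`-valued data at `p` cannot be associated to sprinklings: no invariant probability measure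
exists on `X`, no equivariant measurable map from sprinklings to `X` exists, and none exists even on
a set of sprinklings of nonzero measure under a Poisson process. -/
structure NotDeterminedBySprinklings {d : ℕ} (p : Mink d) (X : Type) [MeasurableSpace X]
    [MulAction (LorentzGroup d) X] : Prop where
  no_invariant_probability : ¬ HasInvariantProbability d X
  no_map : ¬ HasEquivariantMap p X
  no_partial_map : ∀ ρ : ℝ≥0, 0 < ρ → ∀ μ : Measure (Sprinkling d), IsPoissonSprinkling ρ μ →
    ¬ HasPartialEquivariantMap p μ X

/-!
An equivariant map carries a Lorentz invariant finite law on its domain to an invariant probability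
on `X`. The empty sprinkling is a fixed point, and the Poisson law is invariant because Lorentz
transformations preserve volume and the law is determined by its density; so (ii) and (iii) follow
from (i). For (i), a boost along a spatial axis multiplies a null coordinate `x₀ ± xⱼ` by a factor
greater than `1`. Summing the absolute values of this coordinate over the entries of a tuple gives a
permutation invariant function that the boost expands, and by Poincaré recurrence such a function
vanishes almost everywhere for any finite invariant measure. But at every tuple one of these
functions is nonzero.
-/

/-! ### Functions expanded by a measure-preserving action -/

section Expansion

variable {X 𝕜 E : Type*} [MeasurableSpace X] [NormedField 𝕜] [NormedAddCommGroup E]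
  [NormedSpace 𝕜 E] {ν : Measure X}

theorem ae_eq_zero_of_conservative_of_comp_eq_smul {T : X → X} (hT : Conservative T ν) {f : X → E}
    (hf : AEStronglyMeasurable f ν) {c : 𝕜} (hc : 1 < ‖c‖) (hfT : ∀ x, f (T x) = c • f x) :
    f =ᵐ[ν] 0 := by
  have norm_iterate : ∀ n x, ‖f (T^[n] x)‖ = ‖c‖ ^ n * ‖f x‖ := fun n x => by
    induction n with
    | zero => simp
    | succ n ih =>
      rw [Function.iterate_succ_apply', hfT, norm_smul, ih, pow_succ', mul_assoc]
  have recurrence : ∀ᵐ x ∂ν, ∀ N : ℕ, ‖f x‖ ≤ N → ∃ᶠ n in Filter.atTop, ‖f (T^[n] x)‖ ≤ N :=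
    ae_all_iff.mpr fun N => hT.ae_mem_imp_frequently_image_mem (s := {x | ‖f x‖ ≤ N})
      (nullMeasurableSet_le hf.norm.aemeasurable aemeasurable_const)
  filter_upwards [recurrence] with x hx
  by_contra hfx
  obtain ⟨N, hN⟩ := exists_nat_ge ‖f x‖
  have escape : Filter.Tendsto (fun n => ‖f (T^[n] x)‖) Filter.atTop Filter.atTop := by
    simp only [norm_iterate]
    exact (tendsto_pow_atTop_atTop_of_one_lt hc).atTop_mul_const (norm_pos_iff.mpr hfx)
  exact hx N hN ((escape.eventually_gt_atTop (N : ℝ)).mono fun _ => not_le_of_gt)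

theorem measure_eq_zero_of_forall_exists_expanded_ne_zero {G ι : Type*} [SMul G X]
    [MeasurableConstSMul G X] [SMulInvariantMeasure G X ν] [IsFiniteMeasure ν] [Countable ι]
    {f : ι → X → E} (hf : ∀ i, AEStronglyMeasurable (f i) ν) {g : ι → G} {c : ι → 𝕜}
    (hc : ∀ i, 1 < ‖c i‖) (hfg : ∀ i x, f i (g i • x) = c i • f i x)
    (hne : ∀ x, ∃ i, f i x ≠ 0) : ν = 0 := by
  have hzero : ∀ᵐ x ∂ν, ∀ i, f i x = 0 := ae_all_iff.mpr fun i =>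
    ae_eq_zero_of_conservative_of_comp_eq_smul (measurePreserving_smul (g i) ν).conservative
      (hf i) (hc i) (hfg i)
  refine ae_eq_bot.mp (Filter.eventually_false_iff_eq_bot.mp ?_)
  filter_upwards [hzero] with x hx
  obtain ⟨i, hi⟩ := hne x
  exact hi (hx i)

end Expansion

/-! ### Boosts and null coordinates -/

/-- The matrix of the boost of rapidity `t` along the `j`-th spatial axis. -/
noncomputable def boostMatrix {d : ℕ} (j : Fin d) (t : ℝ) : Matrix (Fin (d + 1)) (Fin (d + 1)) ℝ :=
  1 + (Real.cosh t - 1) • (Matrix.single 0 0 1 + Matrix.single j.succ j.succ 1) +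
    Real.sinh t • (Matrix.single 0 j.succ 1 + Matrix.single j.succ 0 1)

section Boost

variable {d : ℕ} (j : Fin d) (t : ℝ)

theorem boostMatrix_mulVec_zero (x : Mink d) :
    (boostMatrix j t *ᵥ x) 0 = Real.cosh t * x 0 + Real.sinh t * x j.succ := by
  simp only [boostMatrix, smul_add, Matrix.smul_single, smul_eq_mul, mul_one, Matrix.add_mulVec,
    Matrix.one_mulVec, Matrix.single_mulVec, Pi.add_apply, Function.update_self, ne_eq,
    (Fin.succ_ne_zero j).symm, not_false_eq_true, Function.update_of_ne, Pi.zero_apply, add_zero]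
  ring

theorem boostMatrix_mulVec_succ_self (x : Mink d) :
    (boostMatrix j t *ᵥ x) j.succ = Real.sinh t * x 0 + Real.cosh t * x j.succ := by
  simp only [boostMatrix, smul_add, Matrix.smul_single, smul_eq_mul, mul_one, Matrix.add_mulVec,
    Matrix.one_mulVec, Matrix.single_mulVec, Pi.add_apply, ne_eq, Fin.succ_ne_zero,
    not_false_eq_true, Function.update_of_ne, Pi.zero_apply, Function.update_self, zero_add]
  ring

variable {j} in
theorem boostMatrix_mulVec_succ_of_ne {i : Fin d} (h : i ≠ j) (x : Mink d) :
    (boostMatrix j t *ᵥ x) i.succ = x i.succ := by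
  simp [boostMatrix, Matrix.add_mulVec, Matrix.single_mulVec, h]

theorem boostMatrix_mulVec_neg_mulVec (x : Mink d) :
    boostMatrix j t *ᵥ boostMatrix j (-t) *ᵥ x = x := by
  have hyperbolic := Real.cosh_sq_sub_sinh_sq t
  ext k
  refine Fin.cases ?time (fun i => ?space) k
  case time =>
    rw [boostMatrix_mulVec_zero, boostMatrix_mulVec_zero, boostMatrix_mulVec_succ_self,
      Real.cosh_neg, Real.sinh_neg]
    linear_combination x 0 * hyperbolic
  case space =>
    obtain rfl | hij := eq_or_ne i j
    · rw [boostMatrix_mulVec_succ_self, boostMatrix_mulVec_zero, boostMatrix_mulVec_succ_self,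
        Real.cosh_neg, Real.sinh_neg]
      linear_combination x i.succ * hyperbolic
    · rw [boostMatrix_mulVec_succ_of_ne _ hij, boostMatrix_mulVec_succ_of_ne _ hij]

theorem boostMatrix_mul_boostMatrix_neg : boostMatrix j t * boostMatrix j (-t) = 1 :=
  Matrix.ext_of_mulVec_single fun i => by
    rw [← Matrix.mulVec_mulVec, boostMatrix_mulVec_neg_mulVec, Matrix.one_mulVec]

theorem minkForm_boostMatrix_mulVec (x y : Mink d) :
    minkForm (boostMatrix j t *ᵥ x) (boostMatrix j t *ᵥ y) = minkForm x y := by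
  have hrest : ∑ i ∈ Finset.univ.erase j,
        (boostMatrix j t *ᵥ x) i.succ * (boostMatrix j t *ᵥ y) i.succ =
      ∑ i ∈ Finset.univ.erase j, x i.succ * y i.succ :=
    Finset.sum_congr rfl fun i hi => by
      rw [boostMatrix_mulVec_succ_of_ne t (Finset.ne_of_mem_erase hi),
        boostMatrix_mulVec_succ_of_ne t (Finset.ne_of_mem_erase hi)]
  rw [minkForm, minkForm, ← Finset.add_sum_erase _ _ (Finset.mem_univ j),
    ← Finset.add_sum_erase _ (fun i : Fin d => x i.succ * y i.succ) (Finset.mem_univ j), hrest,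
    boostMatrix_mulVec_zero, boostMatrix_mulVec_zero, boostMatrix_mulVec_succ_self,
    boostMatrix_mulVec_succ_self]
  linear_combination (x j.succ * y j.succ - x 0 * y 0) * Real.cosh_sq_sub_sinh_sq t

theorem continuous_boostMatrix : Continuous (boostMatrix j) := by
  unfold boostMatrix
  fun_prop

/-- The boost of rapidity `t` along the `j`-th spatial axis, as an element of the full Lorentz
group. -/
noncomputable def fullBoost : fullLorentzGroup d where
  val :=
    { val := boostMatrix j t
      inv := boostMatrix j (-t)
      val_inv := boostMatrix_mul_boostMatrix_neg j t
      inv_val := by simpa using boostMatrix_mul_boostMatrix_neg j (-t) }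
  property := minkForm_boostMatrix_mulVec j t

theorem continuous_fullBoost : Continuous (fullBoost j) := by
  refine Continuous.subtype_mk (Units.continuous_iff.mpr ⟨?_, ?_⟩) _
  · exact continuous_boostMatrix j
  · exact (continuous_boostMatrix j).comp continuous_neg

theorem fullBoost_zero : fullBoost j 0 = 1 :=
  Subtype.ext (Units.ext (by simp [fullBoost, boostMatrix]))

/-- The boost of rapidity `t` along the `j`-th spatial axis, as an element of the identity
component. -/
noncomputable def boost : LorentzGroup d :=
  ⟨fullBoost j t, (isPreconnected_range (continuous_fullBoost j)).subset_connectedComponent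
    ⟨0, fullBoost_zero j⟩ ⟨t, rfl⟩⟩

/-- The null coordinates `x₀ + xⱼ` and `x₀ - xⱼ`, distinguished by a sign. -/
def nullCoord (s : ℤˣ) (x : Mink d) : ℝ :=
  x 0 + (s : ℤ) * x j.succ

theorem measurable_nullCoord (s : ℤˣ) : Measurable (nullCoord j s) := by
  unfold nullCoord
  fun_prop

theorem nullCoord_lorentzVec_boost (s : ℤˣ) (x : Mink d) :
    nullCoord j s (lorentzVec (boost j ((s : ℤ) * t)) x) = Real.exp t * nullCoord j s x := by
  change (boostMatrix j _ *ᵥ x) 0 + (s : ℤ) * (boostMatrix j _ *ᵥ x) j.succ =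
    Real.exp t * (x 0 + (s : ℤ) * x j.succ)
  rw [boostMatrix_mulVec_zero, boostMatrix_mulVec_succ_self, ← Real.cosh_add_sinh]
  rcases Int.units_eq_one_or s with rfl | rfl
  · push_cast
    rw [one_mul]
    ring
  · push_cast
    rw [neg_one_mul, Real.cosh_neg, Real.sinh_neg]
    ring

end Boost

theorem eq_zero_of_forall_nullCoord_eq_zero {d : ℕ} (hd : 0 < d) {x : Mink d}
    (h : ∀ j s, nullCoord j s x = 0) : x = 0 := by
  have coords : ∀ j : Fin d, x 0 = 0 ∧ x j.succ = 0 := fun j => by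
    have hplus := h j 1
    have hminus := h j (-1)
    simp only [nullCoord, Units.val_one, Units.val_neg, Int.cast_one, Int.cast_neg] at hplus hminus
    constructor <;> linarith
  exact funext (Fin.cases (coords ⟨0, hd⟩).1 fun j => (coords j).2)

theorem ne_zero_of_mem_hyperboloid {d : ℕ} {κ : DirKind} {x : Mink d}
    (hx : x ∈ hyperboloid d κ) : x ≠ 0 := by
  rintro rfl
  cases κ <;> simp [hyperboloid, minkForm] at hx

/-! ### Lorentz transformations preserve volume -/

theorem det_mul_self_eq_one_of_transpose_mul_mul_eq {n R : Type*} [Fintype n] [DecidableEq n]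
    [CommRing R] [IsDomain R] {M J : Matrix n n R} (hJ : J.det ≠ 0) (h : Mᵀ * J * M = J) :
    M.det * M.det = 1 := by
  have hdet := congrArg Matrix.det h
  rw [Matrix.det_mul, Matrix.det_mul, Matrix.det_transpose] at hdet
  exact mul_right_cancel₀ hJ (by linear_combination hdet)

/-- The Gram matrix of the Minkowski form. -/
def minkMatrix (d : ℕ) : Matrix (Fin (d + 1)) (Fin (d + 1)) ℝ :=
  Matrix.diagonal (Fin.cons (-1) fun _ => 1)

section Volume

variable {d : ℕ}

theorem minkForm_eq_dotProduct (x y : Mink d) : minkForm x y = x ⬝ᵥ (minkMatrix d *ᵥ y) := by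
  simp [minkForm, minkMatrix, dotProduct, Matrix.mulVec_diagonal, Fin.sum_univ_succ]

theorem det_minkMatrix_ne_zero : (minkMatrix d).det ≠ 0 := by
  simp [minkMatrix, Matrix.det_diagonal, Fin.prod_univ_succ]

theorem transpose_mul_minkMatrix_mul (Λ : fullLorentzGroup d) :
    Λ.val.valᵀ * minkMatrix d * Λ.val.val = minkMatrix d := by
  ext i j
  have hΛ := Λ.property (Pi.single i 1) (Pi.single j 1)
  rw [minkForm_eq_dotProduct, minkForm_eq_dotProduct, Matrix.dotProduct_mulVec,
    Matrix.vecMul_mulVec, ← Matrix.dotProduct_mulVec, Matrix.mulVec_mulVec] at hΛ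
  simpa using hΛ

theorem abs_det_fullLorentzGroup (Λ : fullLorentzGroup d) : |Λ.val.val.det| = 1 :=
  abs_eq_abs.mpr (mul_self_eq_one_iff.mp
    (det_mul_self_eq_one_of_transpose_mul_mul_eq det_minkMatrix_ne_zero
      (transpose_mul_minkMatrix_mul Λ))) |>.trans abs_one

theorem measurePreserving_lorentzVec (Λ : LorentzGroup d) :
    MeasurePreserving (lorentzVec Λ) := by
  have hdet := abs_det_fullLorentzGroup Λ.val
  have hdet_ne : Λ.val.val.val.det ≠ 0 := fun h => by simp [h] at hdet
  refine ⟨(continuous_const.matrix_mulVec continuous_id).measurable, ?_⟩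
  change Measure.map (Matrix.toLin' Λ.val.val.val) volume = volume
  rw [Real.map_matrix_volume_pi_eq_smul_volume_pi hdet_ne, abs_inv, hdet]
  simp

theorem measurePreserving_lorentzAt (p : Mink d) (Λ : LorentzGroup d) :
    MeasurePreserving (lorentzAt p Λ) :=
  (measurePreserving_add_left volume p).comp
    ((measurePreserving_lorentzVec Λ).comp (measurePreserving_sub_right volume p))

/-- A Lorentz transformation about `p`, as a homeomorphism of Minkowski space. -/
def lorentzHomeomorph (p : Mink d) (Λ : LorentzGroup d) : Mink d ≃ₜ Mink d where
  toFun := lorentzAt p Λ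
  invFun := lorentzAt p Λ⁻¹
  left_inv := lorentzAt_inv p Λ
  right_inv x := by simpa using lorentzAt_inv p Λ⁻¹ x
  continuous_toFun := continuous_lorentzAt p Λ
  continuous_invFun := continuous_lorentzAt p Λ⁻¹

end Volume

/-! ### Counts of sprinkled points -/

/-- The cell of the Venn diagram of the regions `B i` consisting of the points that lie in `B i`
exactly for the indices `i ∈ S`. Points outside all regions are left out, so that the cells are
bounded when the regions are. -/
def vennCell {α ι : Type*} (B : ι → Set α) (S : Finset ι) : Set α :=
  {x ∈ ⋃ i, B i | ∀ i, x ∈ B i ↔ i ∈ S}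

section VennCell

variable {α ι : Type*} {B : ι → Set α}

theorem measurableSet_vennCell [MeasurableSpace α] [Countable ι] (hB : ∀ i, MeasurableSet (B i))
    (S : Finset ι) : MeasurableSet (vennCell B S) := by
  have hcell : vennCell B S = (⋃ i, B i) ∩ ⋂ i, {x | x ∈ B i ↔ i ∈ S} := by
    ext x
    simp [vennCell]
  rw [hcell]
  exact (MeasurableSet.iUnion hB).inter
    (MeasurableSet.iInter fun i => (hB i).iff (MeasurableSet.const _))

theorem isBounded_vennCell [Bornology α] [Finite ι] (hB : ∀ i, Bornology.IsBounded (B i))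
    (S : Finset ι) : Bornology.IsBounded (vennCell B S) :=
  (Bornology.isBounded_iUnion.mpr hB).subset fun _ hx => hx.1

theorem pairwise_disjoint_vennCell (B : ι → Set α) :
    Pairwise (Function.onFun Disjoint (vennCell B)) := fun _ _ hST =>
  Set.disjoint_left.mpr fun _ hS hT => hST (Finset.ext fun i => (hS.2 i).symm.trans (hT.2 i))

theorem eq_biUnion_vennCell [Fintype ι] [DecidableEq ι] (B : ι → Set α) (i : ι) :
    B i = ⋃ S ∈ Finset.univ.filter (i ∈ ·), vennCell B S := by
  classical
  ext x
  simp only [Finset.mem_filter, Finset.mem_univ, true_and, Set.mem_iUnion, exists_prop]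
  constructor
  · intro hx
    exact ⟨Finset.univ.filter (x ∈ B ·), by simpa using hx, Set.mem_iUnion.mpr ⟨i, hx⟩, by simp⟩
  · rintro ⟨S, hiS, -, hS⟩
    exact (hS i).mpr hiS

end VennCell

namespace Sprinkling

variable {d : ℕ}

theorem finite_inter (ω : Sprinkling d) {B : Set (Mink d)} (hB : Bornology.IsBounded B) :
    (ω.val ∩ B).Finite :=
  (ω.property _ hB.isCompact_closure).subset (Set.inter_subset_inter_right _ subset_closure)

theorem measurable_count {B : Set (Mink d)} (hB : MeasurableSet B) (hb : Bornology.IsBounded B) :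
    Measurable (count B) :=
  Measurable.of_comap_le
    (le_iSup (fun B : {B : Set (Mink d) // MeasurableSet B ∧ Bornology.IsBounded B} =>
      MeasurableSpace.comap (count B.val) ⊤) ⟨B, hB, hb⟩)

theorem count_biUnion {κ : Type*} {s : Finset κ} {C : κ → Set (Mink d)}
    (hC : ∀ k ∈ s, Bornology.IsBounded (C k)) (hdisj : (s : Set κ).PairwiseDisjoint C)
    (ω : Sprinkling d) : count (⋃ k ∈ s, C k) ω = ∑ k ∈ s, count (C k) ω := by
  have hcard := s.finite_toSet.ncard_biUnion (s := fun k => ω.val ∩ C k)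
    (fun k hk => ω.finite_inter (hC k hk))
    (hdisj.mono fun _ => Set.inter_subset_right)
  rw [finsum_mem_coe_finset] at hcard
  simpa only [count, Set.inter_iUnion₂, Finset.mem_coe] using hcard

theorem count_eq_sum_vennCell {ι : Type*} [Fintype ι] [DecidableEq ι] {B : ι → Set (Mink d)}
    (hB : ∀ i, Bornology.IsBounded (B i)) (i : ι) (ω : Sprinkling d) :
    count (B i) ω = ∑ S with i ∈ S, count (vennCell B S) ω := by
  conv_lhs => rw [eq_biUnion_vennCell B i]
  exact count_biUnion (fun S _ => isBounded_vennCell hB S)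
    ((pairwise_disjoint_vennCell B).set_pairwise _) ω

/-- The image of a sprinkling under a homeomorphism of Minkowski space. -/
def map (e : Mink d ≃ₜ Mink d) (ω : Sprinkling d) : Sprinkling d :=
  ⟨e '' ω.val, fun K hK => by
    rw [← Set.image_inter_preimage]
    exact (ω.property _ (e.isCompact_preimage.mpr hK)).image e⟩

variable (e : Mink d ≃ₜ Mink d)

theorem count_map (B : Set (Mink d)) (ω : Sprinkling d) :
    count B (ω.map e) = count (e ⁻¹' B) ω := by
  change (e '' ω.val ∩ B).ncard = (ω.val ∩ e ⁻¹' B).ncard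
  rw [← Set.image_inter_preimage, Set.ncard_image_of_injective _ e.injective]

theorem isBounded_preimage {B : Set (Mink d)} (hB : Bornology.IsBounded B) :
    Bornology.IsBounded (e ⁻¹' B) :=
  (e.isCompact_preimage.mpr hB.isCompact_closure).isBounded.subset
    (Set.preimage_mono subset_closure)

theorem measurable_map : Measurable (map e) := by
  refine Measurable.of_le_map (iSup_le fun B => ?_)
  refine MeasurableSpace.comap_le_iff_le_map.mpr fun s hs => ?_
  change MeasurableSet ((fun ω : Sprinkling d => count B.val (ω.map e)) ⁻¹' s)
  simp only [count_map]
  exact measurable_count (e.continuous.measurable B.property.1)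
    (isBounded_preimage e B.property.2) hs

end Sprinkling

/-! ### Uniqueness and invariance of the Poisson law -/

theorem measure_eq_of_forall_finset_map_restrict_eq {Ω ι : Type*} {𝓧 : ι → Type*}
    [∀ i, MeasurableSpace (𝓧 i)] {X : ∀ i, Ω → 𝓧 i} [mΩ : MeasurableSpace Ω]
    (hmΩ : mΩ = ⨆ i, MeasurableSpace.comap (X i) inferInstance) {μ ν : Measure Ω}
    [IsFiniteMeasure μ]
    (h : ∀ I : Finset ι, μ.map (fun ω => I.restrict (X · ω)) = ν.map fun ω => I.restrict (X · ω)) :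
    μ = ν := by
  have hX : Measurable fun ω i => X i ω := measurable_pi_lambda _ fun i =>
    Measurable.of_comap_le ((le_iSup _ i).trans_eq hmΩ.symm)
  have hlaw : μ.map (fun ω i => X i ω) = ν.map fun ω i => X i ω := by
    have hμ := isProjectiveLimit_map (P := μ) hX.aemeasurable
    simp only [h] at hμ
    have : ∀ I : Finset ι, IsFiniteMeasure (ν.map fun ω => I.restrict (X · ω)) := fun I => by
      rw [← h]
      infer_instance
    exact hμ.unique (isProjectiveLimit_map hX.aemeasurable)
  have hcomap : mΩ = MeasurableSpace.comap (fun ω i => X i ω) MeasurableSpace.pi := by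
    simp only [hmΩ, MeasurableSpace.pi, MeasurableSpace.comap_iSup, MeasurableSpace.comap_comp]
    rfl
  refine Measure.ext fun s hs => ?_
  rw [hcomap] at hs
  obtain ⟨t, ht, rfl⟩ := hs
  rw [← Measure.map_apply hX ht, hlaw, Measure.map_apply hX ht]

theorem iIndepFun_map_iff {Ω Ω' ι : Type*} {β : ι → Type*} [MeasurableSpace Ω]
    [MeasurableSpace Ω'] [∀ i, MeasurableSpace (β i)] {μ : Measure Ω} {T : Ω → Ω'}
    (hT : Measurable T) {f : ∀ i, Ω' → β i} (hf : ∀ i, Measurable (f i)) :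
    iIndepFun f (μ.map T) ↔ iIndepFun (fun i => f i ∘ T) μ := by
  simp only [iIndepFun_iff_measure_inter_preimage_eq_mul]
  refine forall₃_congr fun I s hs => ?_
  have hpre : ∀ i ∈ I, MeasurableSet (f i ⁻¹' s i) := fun i hi => hf i (hs i hi)
  rw [Measure.map_apply hT (I.measurableSet_biInter hpre), Set.preimage_iInter₂,
    Finset.prod_congr rfl fun i hi => Measure.map_apply hT (hpre i hi)]
  rfl

namespace IsPoissonSprinkling

variable {d : ℕ} {ρ : ℝ≥0} {μ ν : Measure (Sprinkling d)}

theorem iIndepFun_count {κ : Type*} [Finite κ] (hμ : IsPoissonSprinkling ρ μ)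
    {C : κ → Set (Mink d)} (hC : ∀ k, MeasurableSet (C k)) (hb : ∀ k, Bornology.IsBounded (C k))
    (hdisj : Pairwise (Function.onFun Disjoint C)) :
    iIndepFun (fun k => Sprinkling.count (C k)) μ := by
  let e := (Finite.equivFin κ).symm
  exact (iIndepFun_precomp_of_bijective e.bijective).mp
    (hμ.indep _ (C ∘ e) (fun _ => hC _) (fun _ => hb _) (hdisj.comp_of_injective e.injective))

theorem map_count_of_pairwise_disjoint {κ : Type*} [Fintype κ] (hμ : IsPoissonSprinkling ρ μ)
    {C : κ → Set (Mink d)} (hC : ∀ k, MeasurableSet (C k)) (hb : ∀ k, Bornology.IsBounded (C k))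
    (hdisj : Pairwise (Function.onFun Disjoint C)) :
    μ.map (fun ω k => Sprinkling.count (C k) ω) =
      Measure.pi fun k => poissonMeasure (ρ * (volume (C k)).toNNReal) := by
  have := hμ.isProbabilityMeasure
  rw [(hμ.iIndepFun_count hC hb hdisj).map_fun_eq_pi_map fun k =>
    (Sprinkling.measurable_count (hC k) (hb k)).aemeasurable]
  simp only [hμ.map_count _ (hC _) (hb _)]

theorem map_count_eq_map_pi_vennCell {ι : Type*} [Fintype ι] [DecidableEq ι]
    (hμ : IsPoissonSprinkling ρ μ) {B : ι → Set (Mink d)} (hB : ∀ i, MeasurableSet (B i))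
    (hb : ∀ i, Bornology.IsBounded (B i)) :
    μ.map (fun ω i => Sprinkling.count (B i) ω) =
      (Measure.pi fun S => poissonMeasure (ρ * (volume (vennCell B S)).toNNReal)).map
        fun c i => ∑ S with i ∈ S, c S := by
  have hcells : Measurable fun (ω : Sprinkling d) S => Sprinkling.count (vennCell B S) ω :=
    measurable_pi_lambda _ fun S =>
      Sprinkling.measurable_count (measurableSet_vennCell hB S) (isBounded_vennCell hb S)
  rw [← hμ.map_count_of_pairwise_disjoint (measurableSet_vennCell hB) (isBounded_vennCell hb)
      (pairwise_disjoint_vennCell B), Measure.map_map (measurable_of_countable _) hcells]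
  congr 1
  funext ω i
  exact Sprinkling.count_eq_sum_vennCell hb i ω

theorem unique (hμ : IsPoissonSprinkling ρ μ) (hν : IsPoissonSprinkling ρ ν) : μ = ν := by
  classical
  have := hμ.isProbabilityMeasure
  refine measure_eq_of_forall_finset_map_restrict_eq
    (X := fun B : {B : Set (Mink d) // MeasurableSet B ∧ Bornology.IsBounded B} =>
      Sprinkling.count B.val) rfl fun I => ?_
  have hmeas : ∀ B : I, MeasurableSet B.val.val := fun B => B.val.property.1
  have hbdd : ∀ B : I, Bornology.IsBounded B.val.val := fun B => B.val.property.2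
  exact (hμ.map_count_eq_map_pi_vennCell hmeas hbdd).trans
    (hν.map_count_eq_map_pi_vennCell hmeas hbdd).symm

variable {e : Mink d ≃ₜ Mink d}

theorem map (hμ : IsPoissonSprinkling ρ μ) (he : MeasurePreserving e) :
    IsPoissonSprinkling ρ (μ.map (Sprinkling.map e)) where
  isProbabilityMeasure := by
    have := hμ.isProbabilityMeasure
    exact Measure.isProbabilityMeasure_map (Sprinkling.measurable_map e).aemeasurable
  map_count B hB hb := by
    have hcount : Sprinkling.count B ∘ Sprinkling.map e = Sprinkling.count (e ⁻¹' B) :=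
      funext (Sprinkling.count_map e B)
    rw [Measure.map_map (Sprinkling.measurable_count hB hb) (Sprinkling.measurable_map e), hcount,
      hμ.map_count _ (he.measurable hB) (Sprinkling.isBounded_preimage e hb),
      he.measure_preimage hB.nullMeasurableSet]
  indep m B hB hb hdisj := by
    refine (iIndepFun_map_iff (Sprinkling.measurable_map e) fun i =>
      Sprinkling.measurable_count (hB i) (hb i)).mpr ?_
    have hcount : ∀ i, Sprinkling.count (B i) ∘ Sprinkling.map e = Sprinkling.count (e ⁻¹' B i) :=
      fun i => funext (Sprinkling.count_map e (B i))
    simp only [hcount]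
    exact hμ.indep m (fun i => e ⁻¹' B i) (fun i => he.measurable (hB i))
      (fun i => Sprinkling.isBounded_preimage e (hb i)) fun i j hij => (hdisj hij).preimage e

theorem measurePreserving_map (hμ : IsPoissonSprinkling ρ μ) (he : MeasurePreserving e) :
    MeasurePreserving (Sprinkling.map e) μ μ :=
  ⟨Sprinkling.measurable_map e, (hμ.map he).unique hμ⟩

theorem measurePreserving_act (hμ : IsPoissonSprinkling ρ μ) (p : Mink d) (Λ : LorentzGroup d) :
    MeasurePreserving (Sprinkling.act p Λ) μ μ :=
  hμ.measurePreserving_map (e := lorentzHomeomorph p Λ) (measurePreserving_lorentzAt p Λ)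

end IsPoissonSprinkling

/-! ### Invariant probabilities from equivariant maps -/

theorem measurePreserving_mapsTo_restrict {Y : Type*} [MeasurableSpace Y] {μ : Measure Y}
    [IsFiniteMeasure μ] {T : Y → Y} (hT : MeasurePreserving T μ μ) {A : Set Y}
    (hA : MeasurableSet A) (hTA : Set.MapsTo T A A) :
    MeasurePreserving (hTA.restrict T A A) (μ.comap Subtype.val) (μ.comap Subtype.val) := by
  have hval := MeasurableEmbedding.subtype_coe hA
  have hrestrict : Measurable (hTA.restrict T A A) :=
    (hT.measurable.comp measurable_subtype_coe).subtype_mk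
  have hpre : T ⁻¹' A =ᵐ[μ] A :=
    (ae_eq_of_subset_of_measure_ge hTA (hT.measure_preimage hA.nullMeasurableSet).le
      hA.nullMeasurableSet (measure_ne_top _ _)).symm
  have hmap : ((μ.comap Subtype.val).map (hTA.restrict T A A)).map Subtype.val =
      (μ.comap (Subtype.val : A → Y)).map Subtype.val := calc
    _ = ((μ.comap (Subtype.val : A → Y)).map Subtype.val).map T := by
      rw [Measure.map_map hval.measurable hrestrict, Measure.map_map hT.measurable hval.measurable]
      rfl
    _ = (μ.restrict (T ⁻¹' A)).map T := by
      rw [map_comap_subtype_coe hA, Measure.restrict_congr_set hpre]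
    _ = μ.restrict A := (hT.restrict_preimage hA).map_eq
    _ = _ := (map_comap_subtype_coe hA μ).symm
  exact ⟨hrestrict, by rw [← hval.comap_map (Measure.map _ _), hmap, hval.comap_map]⟩

section EquivariantMap

variable {d : ℕ} {X : Type} [MeasurableSpace X] [MulAction (LorentzGroup d) X]
  [MeasurableConstSMul (LorentzGroup d) X]

theorem hasInvariantProbability_of_equivariant {Y : Type*} [MeasurableSpace Y]
    [SMul (LorentzGroup d) Y] (ν : Measure Y) [IsFiniteMeasure ν] [NeZero ν]
    [SMulInvariantMeasure (LorentzGroup d) Y ν] {D : Y → X} (hD : Measurable D)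
    (hequiv : ∀ (Λ : LorentzGroup d) y, D (Λ • y) = Λ • D y) : HasInvariantProbability d X :=
  ⟨((ν Set.univ)⁻¹ • ν).map D, Measure.isProbabilityMeasure_map hD.aemeasurable,
    smulInvariantMeasure_map _ D hequiv hD⟩

theorem HasInvariantProbability.of_equivariant {Y : Type} [MeasurableSpace Y]
    [MulAction (LorentzGroup d) Y] (h : HasInvariantProbability d Y) {D : Y → X}
    (hD : Measurable D) (hequiv : ∀ (Λ : LorentzGroup d) y, D (Λ • y) = Λ • D y) :
    HasInvariantProbability d X := by
  obtain ⟨ν, _, _⟩ := h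
  exact hasInvariantProbability_of_equivariant ν hD hequiv

theorem hasInvariantProbability_of_fixed {x : X} (hx : ∀ Λ : LorentzGroup d, Λ • x = x) :
    HasInvariantProbability d X := by
  refine ⟨Measure.dirac x, inferInstance, ⟨fun Λ s hs => ?_⟩⟩
  rw [Measure.dirac_apply' _ hs, Measure.dirac_apply' _ (measurable_const_smul Λ hs)]
  exact Set.indicator_eq_indicator (by rw [Set.mem_preimage, hx]) rfl

variable {p : Mink d}

theorem HasEquivariantMap.hasInvariantProbability (h : HasEquivariantMap p X) :
    HasInvariantProbability d X := by
  obtain ⟨D, -, hequiv⟩ := h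
  let empty : Sprinkling d := ⟨∅, fun K _ => by simp⟩
  have act_empty : ∀ Λ, empty.act p Λ = empty := fun Λ => Subtype.ext (Set.image_empty _)
  exact hasInvariantProbability_of_fixed (x := D empty) fun Λ => by rw [← hequiv, act_empty]

theorem HasPartialEquivariantMap.hasInvariantProbability {μ : Measure (Sprinkling d)}
    [IsFiniteMeasure μ] (hμ : ∀ Λ, MeasurePreserving (Sprinkling.act p Λ) μ μ)
    (h : HasPartialEquivariantMap p μ X) : HasInvariantProbability d X := by
  obtain ⟨A, D, hA, hμA, hD, hequiv⟩ := h
  have hact : ∀ Λ, Set.MapsTo (Sprinkling.act p Λ) A A := fun Λ ω hω => (hequiv Λ ⟨ω, hω⟩).1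
  let ν : Measure A := μ.comap Subtype.val
  have hν : ν ≠ 0 := fun h => hμA (by
    rw [← Measure.restrict_eq_zero, ← map_comap_subtype_coe hA]
    exact (congrArg _ h).trans (Measure.map_zero _))
  let _ : SMul (LorentzGroup d) A := ⟨fun Λ => (hact Λ).restrict (Sprinkling.act p Λ) A A⟩
  have : NeZero ν := ⟨hν⟩
  have : SMulInvariantMeasure (LorentzGroup d) A ν := ⟨fun Λ _ hs =>
    (measurePreserving_mapsTo_restrict (hμ Λ) hA (hact Λ)).measure_preimage hs.nullMeasurableSet⟩
  exact hasInvariantProbability_of_equivariant ν hD fun Λ ω => (hequiv Λ ω).2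

theorem notDeterminedBySprinklings_of_not_hasInvariantProbability
    (h : ¬ HasInvariantProbability d X) : NotDeterminedBySprinklings p X where
  no_invariant_probability := h
  no_map hmap := h hmap.hasInvariantProbability
  no_partial_map ρ _ μ hμ hmap := by
    have := hμ.isProbabilityMeasure
    exact h (hmap.hasInvariantProbability (hμ.measurePreserving_act p))

end EquivariantMap

/-! ### The spaces of directions -/

section Directions

variable {d : ℕ}

instance measurableConstSMul_hyperboloid (κ : DirKind) :
    MeasurableConstSMul (LorentzGroup d) (hyperboloid d κ) where
  measurable_const_smul Λ :=
    ((measurePreserving_lorentzVec Λ).measurable.comp measurable_subtype_coe).subtype_mk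

variable {k : ℕ} (τ : Fin k → DirKind) (G : Subgroup (Equiv.Perm (Fin k)))

instance measurableConstSMul_dirQuotient :
    MeasurableConstSMul (LorentzGroup d) (DirQuotient d τ G) where
  measurable_const_smul Λ :=
    measurable_from_quotient.mpr (measurable_quotient_mk''.comp (measurable_const_smul Λ))

variable {τ}

/-- The sum over the entries of a tuple of the absolute values of a null coordinate: a function of
tuples that is invariant under permutations and expanded by a boost. -/
def nullSum (j : Fin d) (s : ℤˣ) (v : DirTuple d τ) : ℝ :=
  ∑ i, |nullCoord j s (v i)|

theorem measurable_nullSum (j : Fin d) (s : ℤˣ) : Measurable (nullSum (τ := τ) j s) :=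
  Finset.measurable_sum _ fun i _ =>
    ((measurable_nullCoord j s).comp (measurable_subtype_coe.comp (measurable_pi_apply i))).abs

theorem nullSum_boost_smul (j : Fin d) (s : ℤˣ) (t : ℝ) (v : DirTuple d τ) :
    nullSum j s (boost j ((s : ℤ) * t) • v) = Real.exp t * nullSum j s v := by
  rw [nullSum, nullSum, Finset.mul_sum]
  refine Finset.sum_congr rfl fun i _ => ?_
  change |nullCoord j s (lorentzVec _ (v i))| = _
  rw [nullCoord_lorentzVec_boost, abs_mul, Real.abs_exp]

theorem exists_nullSum_ne_zero (hd : 0 < d) (hk : 0 < k) (v : DirTuple d τ) :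
    ∃ i : Fin d × ℤˣ, nullSum i.1 i.2 v ≠ 0 := by
  by_contra! h
  refine ne_zero_of_mem_hyperboloid (v ⟨0, hk⟩).property
    (eq_zero_of_forall_nullCoord_eq_zero hd fun j s => abs_eq_zero.mp ?_)
  exact (Finset.sum_eq_zero_iff_of_nonneg fun _ _ => abs_nonneg _).mp (h (j, s)) _
    (Finset.mem_univ _)

variable {G} in
theorem nullSum_eq_of_permSetoid (j : Fin d) (s : ℤˣ) {v w : DirTuple d τ}
    (h : permSetoid d τ G v w) : nullSum j s v = nullSum j s w := by
  obtain ⟨g, -, hg⟩ := h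
  simp only [nullSum, hg]
  exact (Equiv.sum_comp g fun i => |nullCoord j s (v i)|).symm

theorem not_hasInvariantProbability_dirQuotient (hd : 0 < d) (hk : 0 < k) :
    ¬ HasInvariantProbability d (DirQuotient d τ G) := by
  rintro ⟨ν, hν, hinv⟩
  let f (i : Fin d × ℤˣ) : DirQuotient d τ G → ℝ :=
    Quotient.lift (nullSum i.1 i.2) fun _ _ h => nullSum_eq_of_permSetoid i.1 i.2 h
  have hf : ∀ i, Measurable (f i) := fun i =>
    measurable_from_quotient.mpr (measurable_nullSum i.1 i.2)
  refine hν.ne_zero ν (measure_eq_zero_of_forall_exists_expanded_ne_zero (f := f)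
    (g := fun i => boost i.1 ((i.2 : ℤ) * 1)) (c := fun _ => Real.exp 1)
    (fun i => (hf i).aestronglyMeasurable) (fun _ => ?_)
    (fun i q => Quotient.inductionOn q (nullSum_boost_smul i.1 i.2 1))
    fun q => Quotient.inductionOn q (exists_nullSum_ne_zero hd hk))
  rw [Real.norm_eq_abs, Real.abs_exp, Real.one_lt_exp_iff]
  exact one_pos

theorem not_hasInvariantProbability_dirTuple (hd : 0 < d) (hk : 0 < k) :
    ¬ HasInvariantProbability d (DirTuple d τ) := fun h =>
  not_hasInvariantProbability_dirQuotient ⊥ hd hk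
    (h.of_equivariant (D := Quotient.mk _) measurable_quotient_mk'' fun _ _ => rfl)

theorem not_hasInvariantProbability_hyperboloid (hd : 0 < d) (κ : DirKind) :
    ¬ HasInvariantProbability d (hyperboloid d κ) := fun h =>
  not_hasInvariantProbability_dirTuple (τ := fun _ : Fin 1 => κ) hd one_pos
    (h.of_equivariant (D := fun x _ => x) (measurable_pi_lambda _ fun _ => measurable_id)
      fun _ _ => rfl)

end Directions

theorem mainTheorem3 (d : ℕ) (hd : 1 < d + 1) (p : Mink d) :
    NotDeterminedBySprinklings p (hyperboloid d DirKind.spacelike) ∧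
    ∀ (k : ℕ) (_ : 1 ≤ k) (τ : Fin k → DirKind),
      NotDeterminedBySprinklings p (DirTuple d τ) ∧
      ∀ G : Subgroup (Equiv.Perm (Fin k)), (∀ g ∈ G, ∀ i, τ (g i) = τ i) →
        NotDeterminedBySprinklings p (DirQuotient d τ G) := by
  have hd' : 0 < d := Nat.lt_add_left_iff_pos.mp hd
  refine ⟨?spacelike, fun k hk τ => ⟨?tuple, fun G _ => ?quotient⟩⟩ <;>
    apply notDeterminedBySprinklings_of_not_hasInvariantProbability
  case spacelike => exact not_hasInvariantProbability_hyperboloid hd' _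
  case tuple => exact not_hasInvariantProbability_dirTuple hd' hk
  case quotient => exact not_hasInvariantProbability_dirQuotient G hd' hk
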